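/- **Notation.** For $r\le p$ let $\mathbb{O}_{p,r}=\{U\in\mathbb{R}^{p\times r}: U^\top U=I_r\}$; for $U\in\mathbb{O}_{p,r}$ let $P_U=UU^\top$ and let $U_\perp\in\mathbb{O}_{p,p-r}$ be an orthonormal complement of $U$ (so $U^\top U_\perp=0$). For $A\in\mathbb{R}^{p_1\times\cdots\times p_d}$, $\mathcal{M}_k(A)\in\mathbb{R}^{p_k\times\prod_{j\ne k}p_j}$ is the mode-$k$ matricization, $A\times_k B$ is the mode-$k$ product with a matrix $B$ with $p_k$ columns, that is, $(A\times_k B)_{i_1\ldots i_{k-1}\,j\,i_{k+1}\ldots i_d}=\sum_{i_k}A_{i_1\ldots i_d}B_{j i_k}$, and the Tucker rank of $A$ is the tuple $(\mathrm{rank}\,\mathcal{M}_1(A),\ldots,\mathrm{rank}\,\mathcal{M}_d(A))$. $\|\cdot\|$ is the spectral norm of a matrix and $\|\cdot\|_{\rm F}$ the Frobenius norm. $\mathrm{SVD}_r(D)$ denotes a matrix whose columns are the $r$ leading left singular vectors in some (full) singular value decomposition of $D$. For a tensor $Z\in\mathbb{R}^{p_1\times\cdots\times p_d}$ and $\mathbf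 r=(r_1,\ldots,r_d)$, let $Z_{\max(\mathbf r)}=Z\times_{k=1}^d P_{\widehat U_k}$, where $(\widehat U_1,\ldots,\widehat U_d)$ maximizes $\|Z\times_{k=1}^d P_{U_k}\|_{\rm F}$ over all $U_k\in\mathbb{O}_{p_k,r_k}$, $k=1,\ldots,d$. **Algorithm (one-iteration HOOI).** Input: $\widetilde T\in\mathbb{R}^{p_1\times\cdots\times p_d}$, a rank $\mathbf r=(r_1,\ldots,r_d)$ and initializations $\widetilde U_k^0\in\mathbb{O}_{p_k,r_k}$, $k=1,\ldots,d$. For $k=1,\ldots,d$ compute $$\widetilde U_k^1=\mathrm{SVD}_{r_k}\Big(\mathcal{M}_k\big(\widetilde T\times_{j<k}(\widetilde U_j^0)^\top\times_{j>k}(\widetilde U_j^0)^\top\big)\Big).$$ Output: $\widehat T=\widetilde T\times_{k=1}^d P_{\widetilde U_k^1}$. **Theorem (Perturbation Bound for Over-parameterized Tensor Decomposition).** Let $T,\widetilde T\in\mathbb{R}^{p_1\times\cdots\times p_d}$, where $T$ has Tucker rank $\mathbf r^*=(r_1^*,\ldots,r_d^*)$ and Tucker decomposition $T=B\times_1U_1\times\cdots\times_dU_d$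 with $B\in\mathbb{R}^{r_1^*\times\cdots\times r_d^*}$ and $U_k\in\mathbb{O}_{p_k,r_k^*}$, and let $Z=\widetilde T-T$. Run one-iteration HOOI with input $\widetilde T$, rank $\mathbf r=(r_1,\ldots,r_d)$ with $r_k\ge r_k^*$ for all $k$, and initializations $\widetilde U_k^0\in\mathbb{O}_{p_k,r_k}$ satisfying $$\max_{k=1,\ldots,d}\big\|(\widetilde U^0_{k\perp})^\top U_k\big\|\le\frac{\sqrt2}{2}.$$ Then, whatever choice of singular vectors is made in the algorithm, its output $\widehat T$ satisfies $$\|\widehat T-T\|_{\rm F}\le\big(2^{\frac{d+1}{2}}\cdot d+1\big)\,\|Z_{\max(\mathbf r)}\|_{\rm F}.$$ -/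

import Mathlib

namespace TuckerHOOI

/-- Real order-`d` tensors of size `p 0 × ⋯ × p (d-1)`. -/
abbrev Tensor {d : ℕ} (p : Fin d → ℕ) : Type := ((k : Fin d) → Fin (p k)) → ℝ

/-- The Frobenius norm of a tensor. -/
noncomputable def frobNorm {d : ℕ} {p : Fin d → ℕ} (A : Tensor p) : ℝ :=
  Real.sqrt (∑ i, A i ^ 2)

/-- The mode-`k` matricization. The columns are indexed by the multi-indices over the
remaining modes (instead of by the number of such a multi-index in a fixed enumeration). -/
def matricize {d : ℕ} {p : Fin d → ℕ} (k : Fin d) (A : Tensor p) :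
    Matrix (Fin (p k)) ((j : {j : Fin d // j ≠ k}) → Fin (p j)) ℝ :=
  Matrix.of fun i e => A ((Equiv.piSplitAt k (fun j => Fin (p j))).symm (i, e))

/-- The Tucker rank of a tensor: the tuple of the ranks of its matricizations. -/
noncomputable def tuckerRank {d : ℕ} {p : Fin d → ℕ} (A : Tensor p) : Fin d → ℕ :=
  fun k => (matricize k A).rank

/-- The multi-mode product `A ×₁ B₁ × ⋯ ×_d B_d`. -/
def modeProd {d : ℕ} {p q : Fin d → ℕ} (A : Tensor p)
    (B : (k : Fin d) → Matrix (Fin (q k)) (Fin (p k)) ℝ) : Tensor q :=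
  fun i => ∑ j : (k : Fin d) → Fin (p k), (∏ k, B k (i k) (j k)) * A j

/-- The mode-`k` matricization of the tensor `A ×_{j ≠ k} B_j`, in which every mode except the
`k`-th one is multiplied by a matrix. -/
def matricizeModeProdExcept {d : ℕ} {p q : Fin d → ℕ} (k : Fin d) (A : Tensor p)
    (B : (j : Fin d) → Matrix (Fin (q j)) (Fin (p j)) ℝ) :
    Matrix (Fin (p k)) ((j : {j : Fin d // j ≠ k}) → Fin (q j)) ℝ :=
  Matrix.of fun i c => ∑ e : (j : {j : Fin d // j ≠ k}) → Fin (p j),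
    (∏ j : {j : Fin d // j ≠ k}, B j (c j) (e j)) * matricize k A i e

/-- Multiplying the remaining mode as well gives the matricization of the full product. -/
theorem matricize_modeProd {d : ℕ} {p q : Fin d → ℕ} (k : Fin d) (A : Tensor p)
    (B : (j : Fin d) → Matrix (Fin (q j)) (Fin (p j)) ℝ) :
    matricize k (modeProd A B) = B k * matricizeModeProdExcept k A B := by
  ext i c
  simp only [matricize, modeProd, matricizeModeProdExcept, Matrix.mul_apply, Matrix.of_apply,
    Finset.mul_sum]
  rw [← Fintype.sum_prod_type',
    ← (Equiv.piSplitAt k (fun j => Fin (p j))).symm.sum_comp]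
  refine Finset.sum_congr rfl fun x _ => ?_
  rw [← mul_assoc]
  congr 1
  rw [Fintype.prod_eq_mul_prod_subtype_ne _ k]
  congr 1
  · simp [Equiv.piSplitAt]
  · refine Finset.prod_congr rfl fun j _ => ?_
    simp [Equiv.piSplitAt, j.2]

/-- `U ∈ 𝕆_{p,r}`: the columns of `U` are orthonormal. -/
def OrthonormalColumns {m n : Type*} [Fintype m] [DecidableEq n] (U : Matrix m n ℝ) : Prop :=
  U.transpose * U = 1

/-- `P_U = U Uᵀ`. -/
def proj {m r : ℕ} (U : Matrix (Fin m) (Fin r) ℝ) : Matrix (Fin m) (Fin m) ℝ :=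
  U * U.transpose

/-- `V ∈ 𝕆_{m,m-r}` is an orthonormal complement `U_⊥` of `U ∈ 𝕆_{m,r}`. -/
def IsOrthonormalComplement {m r : ℕ} (U : Matrix (Fin m) (Fin r) ℝ)
    (V : Matrix (Fin m) (Fin (m - r)) ℝ) : Prop :=
  OrthonormalColumns V ∧ U.transpose * V = 0

open scoped Matrix.Norms.L2Operator in
/-- The spectral norm of a matrix (the operator norm for the Euclidean norms). -/
noncomputable def specNorm {m n : ℕ} (M : Matrix (Fin m) (Fin n) ℝ) : ℝ := ‖M‖

/-- `D = W Σ Vᵀ` is a (full) singular value decomposition of `D`: `W` and `V` are square with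
orthonormal columns and `Σ` is the rectangular diagonal matrix of the singular values
`σ 0 ≥ σ 1 ≥ ⋯ ≥ 0`. -/
structure IsSVD {m : ℕ} {κ : Type*} [Fintype κ] (D : Matrix (Fin m) κ ℝ)
    (W : Matrix (Fin m) (Fin m) ℝ) (σ : ℕ → ℝ) (V : Matrix κ (Fin (Fintype.card κ)) ℝ) :
    Prop where
  left_orthonormal : OrthonormalColumns W
  right_orthonormal : OrthonormalColumns V
  nonneg : ∀ i, 0 ≤ σ i
  antitone : Antitone σ
  eq_mul : D = W * Matrix.of (fun (i : Fin m) (j : Fin (Fintype.card κ)) =>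
    if (i : ℕ) = (j : ℕ) then σ i else 0) * V.transpose

/-- `U = SVD_r(D)`: the columns of `U` are the `r` leading left singular vectors of `D`, in some
singular value decomposition of `D`. -/
def IsSVDLeft {m : ℕ} {κ : Type*} [Fintype κ] (D : Matrix (Fin m) κ ℝ) (r : ℕ)
    (U : Matrix (Fin m) (Fin r) ℝ) : Prop :=
  ∃ (hr : r ≤ m) (W : Matrix (Fin m) (Fin m) ℝ) (σ : ℕ → ℝ)
    (V : Matrix κ (Fin (Fintype.card κ)) ℝ),
    IsSVD D W σ V ∧ U = W.submatrix id (Fin.castLE hr)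

/-- `Y = Z_{max(r)}`: the tensor `Z ×_k P_{Û_k}` where `(Û_1, …, Û_d)` maximizes
`‖Z ×_k P_{U_k}‖_F` over all `U_k ∈ 𝕆_{p_k,r_k}`. -/
def IsMaxTucker {d : ℕ} {p : Fin d → ℕ} (Z : Tensor p) (r : Fin d → ℕ) (Y : Tensor p) : Prop :=
  ∃ U : (k : Fin d) → Matrix (Fin (p k)) (Fin (r k)) ℝ,
    (∀ k, OrthonormalColumns (U k)) ∧
    (∀ U' : (k : Fin d) → Matrix (Fin (p k)) (Fin (r k)) ℝ, (∀ k, OrthonormalColumns (U' k)) →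
      frobNorm (modeProd Z fun k => proj (U' k)) ≤ frobNorm (modeProd Z fun k => proj (U k))) ∧
    Y = modeProd Z fun k => proj (U k)

/-- `Z_{max(r)}` exists. -/
theorem exists_isMaxTucker {d : ℕ} {p : Fin d → ℕ} (Z : Tensor p) (r : Fin d → ℕ)
    (hr : ∀ k, r k ≤ p k) : ∃ Y, IsMaxTucker Z r Y := by
  have hc : ∀ k, IsCompact {U : Matrix (Fin (p k)) (Fin (r k)) ℝ | OrthonormalColumns U} := by
    intro k
    have hcl : IsClosed {U : Matrix (Fin (p k)) (Fin (r k)) ℝ | OrthonormalColumns U} :=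
      isClosed_eq (by fun_prop) continuous_const
    refine IsCompact.of_isClosed_subset (s := Set.univ.pi fun _ => Set.univ.pi fun _ => Set.Icc (-1:ℝ) 1)
      (isCompact_univ_pi fun _ => isCompact_univ_pi fun _ => isCompact_Icc) hcl ?_
    intro U hU i _ j _
    have h : ∑ x, U x j * U x j = 1 := by
      have h0 := congrFun (congrFun hU j) j
      rwa [Matrix.one_apply_eq] at h0
    have h1 : U i j * U i j ≤ ∑ x, U x j * U x j :=
      Finset.single_le_sum (f := fun x => U x j * U x j) (fun x _ => mul_self_nonneg _) (Finset.mem_univ i)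
    exact ⟨by nlinarith, by nlinarith⟩
  have hne : (Set.univ.pi fun k => {U : Matrix (Fin (p k)) (Fin (r k)) ℝ | OrthonormalColumns U}).Nonempty := by
    refine ⟨fun k => (1 : Matrix (Fin (p k)) (Fin (p k)) ℝ).submatrix id (Fin.castLE (hr k)), fun k _ => ?_⟩
    rw [Set.mem_ofPred_eq, OrthonormalColumns]
    rw [Matrix.transpose_submatrix, ← Matrix.submatrix_mul _ _ _ _ _ Function.bijective_id,
      Matrix.transpose_one, one_mul, Matrix.submatrix_one _ (Fin.castLE_injective (hr k))]
  have hcont : Continuous fun U : (k : Fin d) → Matrix (Fin (p k)) (Fin (r k)) ℝ =>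
      frobNorm (modeProd Z fun k => proj (U k)) := by
    unfold frobNorm modeProd proj
    simp only [Matrix.mul_apply, Matrix.transpose_apply]
    have : ∀ (k : Fin d) a b, Continuous fun U : (k : Fin d) → Matrix (Fin (p k)) (Fin (r k)) ℝ => U k a b :=
      fun k a b => (continuous_apply b).comp ((continuous_apply a).comp (continuous_apply k))
    fun_prop
  obtain ⟨U, hU, hmax⟩ := (isCompact_univ_pi hc).exists_isMaxOn hne hcont.continuousOn
  exact ⟨_, U, fun k => hU k trivial, fun U' h => hmax (fun k _ => h k), rfl⟩

/-- `That` is an output of one-iteration HOOI with input tensor `T'`, input rank `r` and initial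
matrices `U0 k ∈ 𝕆_{p_k,r_k}`: for every mode `k` one computes
`U1 k = SVD_{r_k}(M_k(T' ×_{j ≠ k} (U0 j)ᵀ))`, and the output is `T' ×_k P_{U1 k}`. -/
def IsOHOOIOutput {d : ℕ} {p : Fin d → ℕ} (T' : Tensor p) (r : Fin d → ℕ)
    (U0 : (k : Fin d) → Matrix (Fin (p k)) (Fin (r k)) ℝ) (That : Tensor p) : Prop :=
  ∃ U1 : (k : Fin d) → Matrix (Fin (p k)) (Fin (r k)) ℝ,
    (∀ k, IsSVDLeft (matricizeModeProdExcept k T' fun j => (U0 j).transpose) (r k) (U1 k)) ∧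
    That = modeProd T' fun k => proj (U1 k)

end TuckerHOOI

namespace TuckerHOOI

open Matrix

/-! Write `P k` for the projection onto the computed `U1 k`. The error splits as `(T ×_k P k - T) +
Z ×_k P k`, and the last term is at most `Z_max` in norm by maximality. Replacing the identity by `P
k` one mode at a time bounds the first term by the sum over `k` of the norms of `T ×_k (1 - P k)`
(`frobNorm_modeProd_sub_le`), so each summand has to be at most `2 ^ ((d + 1) / 2)` times the norm
of `Z_max`.

Two estimates give this. By the initialization condition, inserting the projection onto `U0 j` in a
mode `j ≠ k` shrinks `T` by at most a factor `√2` (`frobSq_mul_le_two_mul`), hence by at most `2 ^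
((d - 1) / 2)` over all these modes (`frobNorm_modeProd_sq_le`). What remains is the part of the
compressed signal matrix missed by the leading left singular space of signal plus noise;
`IsSVDLeft.sqrt_frobSq_le` bounds it by twice the largest rank-`r k` part of the compressed noise,
with no spectral gap. That part is a projection of `Z` admissible in the definition of `Z_max`. -/

/-- The squared Frobenius norm of a matrix. -/
def frobSq {m n : Type*} [Fintype m] [Fintype n] (M : Matrix m n ℝ) : ℝ :=
  ∑ i, ∑ j, M i j ^ 2

/-! ### Frobenius norm: isometries and the triangle inequality -/

section FrobSq

variable {m n l : Type*} [Fintype m] [Fintype n] [Fintype l]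

theorem frobSq_nonneg (M : Matrix m n ℝ) : 0 ≤ frobSq M :=
  Finset.sum_nonneg fun _ _ => Finset.sum_nonneg fun _ _ => sq_nonneg _

theorem frobSq_transpose (M : Matrix m n ℝ) : frobSq Mᵀ = frobSq M :=
  Finset.sum_comm

theorem frobSq_eq_trace (M : Matrix m n ℝ) : frobSq M = (Mᵀ * M).trace := by
  simp only [frobSq, trace, diag, mul_apply, transpose_apply, sq]
  exact Finset.sum_comm

theorem frobSq_mul_of_orthonormalColumns [DecidableEq m] {U : Matrix l m ℝ}
    (hU : OrthonormalColumns U) (M : Matrix m n ℝ) : frobSq (U * M) = frobSq M := by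
  rw [frobSq_eq_trace, frobSq_eq_trace, transpose_mul, Matrix.mul_assoc,
    ← Matrix.mul_assoc Uᵀ, show Uᵀ * U = 1 from hU, Matrix.one_mul]

theorem frobSq_mul_transpose_of_orthonormalColumns [DecidableEq n] {U : Matrix l n ℝ}
    (hU : OrthonormalColumns U) (M : Matrix m n ℝ) : frobSq (M * Uᵀ) = frobSq M := by
  rw [← frobSq_transpose, transpose_mul, transpose_transpose,
    frobSq_mul_of_orthonormalColumns hU, frobSq_transpose]

theorem sqrt_sum_sq_add_le {ι : Type*} [Fintype ι] (f g : ι → ℝ) :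
    √(∑ i, (f i + g i) ^ 2) ≤ √(∑ i, f i ^ 2) + √(∑ i, g i ^ 2) := by
  have h := norm_add_le (WithLp.toLp 2 f : EuclideanSpace ℝ ι) (WithLp.toLp 2 g)
  simpa [EuclideanSpace.norm_eq] using h

theorem sqrt_frobSq_add_le (M N : Matrix m n ℝ) :
    √(frobSq (M + N)) ≤ √(frobSq M) + √(frobSq N) := by
  simpa only [frobSq, ← Fintype.sum_prod_type', Matrix.add_apply] using
    sqrt_sum_sq_add_le (fun x : m × n => M x.1 x.2) (fun x => N x.1 x.2)

end FrobSq

/-! ### Orthonormal columns: existence and extension -/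

section Orthonormal

theorem OrthonormalColumns.card_le {m n : Type*} [Fintype m] [Fintype n] [DecidableEq n]
    {U : Matrix m n ℝ} (hU : OrthonormalColumns U) : Fintype.card n ≤ Fintype.card m := by
  have h : (Uᵀ * U).rank = Fintype.card n := by
    rw [show Uᵀ * U = 1 from hU, rank_one]
  rw [← h]
  exact (rank_mul_le_right _ _).trans (rank_le_card_height _)

theorem OrthonormalColumns.fromCols {m n l : Type*} [Fintype m] [DecidableEq n] [DecidableEq l]
    {U : Matrix m n ℝ} {V : Matrix m l ℝ} (hU : OrthonormalColumns U)
    (hV : OrthonormalColumns V) (h : Uᵀ * V = 0) :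
    OrthonormalColumns (Matrix.fromCols U V) := by
  have h' : Vᵀ * U = 0 := by simpa using congrArg transpose h
  rw [OrthonormalColumns] at *
  rw [transpose_fromCols, fromRows_mul_fromCols, hU, hV, h, h', fromBlocks_one]

/-- The row sum is a diagonal entry of the symmetric idempotent `P = X * Xᵀ`, and `P i i = ∑ j, P i
j ^ 2 ≥ P i i ^ 2`. -/
theorem OrthonormalColumns.sum_row_sq_le_one {m n : Type*} [Fintype m] [Fintype n]
    [DecidableEq n] {X : Matrix m n ℝ} (hX : OrthonormalColumns X) (i : m) :
    ∑ j, X i j ^ 2 ≤ 1 := by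
  have h : X * Xᵀ * (X * Xᵀ) = X * Xᵀ := by
    rw [Matrix.mul_assoc, ← Matrix.mul_assoc Xᵀ, show Xᵀ * X = 1 from hX, Matrix.one_mul]
  have hd : (X * Xᵀ) i i = ∑ j, X i j ^ 2 := by simp [mul_apply, sq]
  have hs : ∀ j, (X * Xᵀ) j i = (X * Xᵀ) i j := fun j => by simp [mul_apply, mul_comm]
  have h1 : (X * Xᵀ) i i = ∑ j, (X * Xᵀ) i j ^ 2 := by
    conv_lhs => rw [← h]
    rw [mul_apply]
    exact Finset.sum_congr rfl fun j _ => by rw [hs, sq]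
  have h2 : (X * Xᵀ) i i ^ 2 ≤ (X * Xᵀ) i i := by
    conv_rhs => rw [h1]
    exact Finset.single_le_sum (f := fun j => (X * Xᵀ) i j ^ 2)
      (fun j _ => sq_nonneg _) (Finset.mem_univ i)
  rw [← hd]
  nlinarith

theorem OrthonormalColumns.frobSq_eq {m n : Type*} [Fintype m] [Fintype n]
    [DecidableEq n] {X : Matrix m n ℝ} (hX : OrthonormalColumns X) :
    frobSq X = Fintype.card n := by
  rw [frobSq_eq_trace, show Xᵀ * X = 1 from hX, trace_one]

/-- A subspace of dimension at least `s` contains `s` orthonormal vectors; if its dimension is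
exactly `s`, they span it. -/
theorem exists_orthonormalColumns_mem {m s : ℕ} (S : Submodule ℝ (Fin m → ℝ))
    (hs : s ≤ Module.finrank ℝ S) :
    ∃ N : Matrix (Fin m) (Fin s) ℝ, OrthonormalColumns N ∧ (∀ j, N.col j ∈ S) ∧
      (s = Module.finrank ℝ S → ∀ v ∈ S, N *ᵥ (Nᵀ *ᵥ v) = v) := by
  let e : EuclideanSpace ℝ (Fin m) ≃ₗ[ℝ] (Fin m → ℝ) := WithLp.linearEquiv 2 ℝ (Fin m → ℝ)
  let S' : Submodule ℝ (EuclideanSpace ℝ (Fin m)) := S.comap e.toLinearMap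
  have hfin : Module.finrank ℝ S' = Module.finrank ℝ S := by
    have : S' = S.map e.symm.toLinearMap := by
      exact Submodule.comap_equiv_eq_map_symm e S
    rw [this]
    exact LinearEquiv.finrank_map_eq e.symm S
  let b := (stdOrthonormalBasis ℝ S').reindex (finCongr hfin)
  let N : Matrix (Fin m) (Fin s) ℝ :=
    Matrix.of fun i j => (b (Fin.castLE hs j) : EuclideanSpace ℝ (Fin m)) i
  have hN : OrthonormalColumns N := by
    ext i j
    have h := orthonormal_iff_ite.mp b.orthonormal (Fin.castLE hs j) (Fin.castLE hs i)
    simp only [Submodule.coe_inner, PiLp.inner_apply, RCLike.inner_apply, conj_trivial,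
      Fin.castLE_inj] at h
    simp only [mul_apply, transpose_apply, N, of_apply, one_apply]
    rw [h]
    simp only [eq_comm]
  refine ⟨N, hN, fun j => (b (Fin.castLE hs j)).2, ?_⟩
  intro hse v hv
  subst hse
  have h := congrArg (fun x : S' => e x) (b.sum_repr' ⟨e.symm v, by simpa [S'] using hv⟩)
  have h' : ∑ x, inner ℝ (b x : EuclideanSpace ℝ (Fin m)) (e.symm v) • e (b x) = v := by
    simpa using h
  conv_rhs => rw [← h']
  ext i
  simp only [mulVec, dotProduct, Finset.sum_apply, Pi.smul_apply, smul_eq_mul]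
  refine Finset.sum_congr rfl fun j _ => ?_
  rw [mul_comm]
  congr 1
  simp only [PiLp.inner_apply, RCLike.inner_apply, conj_trivial]
  exact Finset.sum_congr rfl fun l _ => mul_comm _ _

theorem finrank_ker_mulVecLin {κ : Type*} {n : ℕ} (M : Matrix κ (Fin n) ℝ) :
    Module.finrank ℝ (LinearMap.ker M.mulVecLin) + M.rank = n := by
  have := LinearMap.finrank_range_add_finrank_ker M.mulVecLin
  simp only [Module.finrank_fin_fun] at this
  rw [Matrix.rank]
  omega

/-- Enlarging a family of orthonormal columns. -/
theorem OrthonormalColumns.exists_extension {m s r : ℕ} {N : Matrix (Fin m) (Fin s) ℝ}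
    (hN : OrthonormalColumns N) (hsr : s ≤ r) (hrm : r ≤ m) :
    ∃ V : Matrix (Fin m) (Fin r) ℝ, OrthonormalColumns V ∧
      ∀ {κ : Type} [Fintype κ] (E : Matrix (Fin m) κ ℝ), frobSq (Nᵀ * E) ≤ frobSq (Vᵀ * E) := by
  have hk := finrank_ker_mulVecLin Nᵀ
  have hr : Nᵀ.rank ≤ s := by simpa using Nᵀ.rank_le_card_height
  obtain ⟨N', hN', hmem, -⟩ := exists_orthonormalColumns_mem (s := r - s)
    (LinearMap.ker Nᵀ.mulVecLin) (by omega)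
  have h0 : Nᵀ * N' = 0 := by
    ext i j
    exact congrFun (LinearMap.mem_ker.mp (hmem j)) i
  let e : Fin r ≃ Fin s ⊕ Fin (r - s) := (finCongr (by omega)).trans finSumFinEquiv.symm
  refine ⟨(Matrix.fromCols N N').submatrix id e, ?_, ?_⟩
  · rw [OrthonormalColumns, transpose_submatrix, ← submatrix_mul _ _ _ _ _ Function.bijective_id,
      hN.fromCols hN' h0, submatrix_one_equiv]
  · intro κ _ E
    have : frobSq (((Matrix.fromCols N N').submatrix id e)ᵀ * E)
        = frobSq (Nᵀ * E) + frobSq (N'ᵀ * E) := by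
      rw [frobSq, ← e.symm.sum_comp, Fintype.sum_sum_type]
      simp [frobSq, mul_apply]
    rw [this]
    exact le_add_of_nonneg_right (frobSq_nonneg _)

end Orthonormal

/-! ### Comparison of weighted sums of a decreasing sequence -/

theorem sum_ite_mem_Ico {m r s : ℕ} (h : r + s ≤ m) :
    ∑ i : Fin m, (if r ≤ (i : ℕ) ∧ (i : ℕ) < r + s then (1 : ℝ) else 0) = s := by
  rw [Fin.sum_univ_eq_sum_range (fun i => if r ≤ i ∧ i < r + s then (1 : ℝ) else 0) m,
    ← Finset.sum_filter]
  have : (Finset.range m).filter (fun i => r ≤ i ∧ i < r + s) = Finset.Ico r (r + s) := by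
    ext i
    simp only [Finset.mem_filter, Finset.mem_range, Finset.mem_Ico]
    omega
  simp [this]

/-- Weights in `[0, 1]` of total mass `s` on the first `r + s` indices give a decreasing
sequence a larger mean than weights of the same mass avoiding the first `r` indices. -/
theorem sum_mul_le_sum_mul_of_antitone {m r s : ℕ} (h : r + s ≤ m) {w : ℕ → ℝ}
    (hw : Antitone w) {c c' : Fin m → ℝ} (hc0 : ∀ i, 0 ≤ c i) (hc1 : ∀ i, c i ≤ 1)
    (hc : ∑ i, c i = s) (hc0' : ∀ i, 0 ≤ c' i) (hc1' : ∀ i, c' i ≤ 1) (hc' : ∑ i, c' i = s)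
    (hsupp : ∀ i : Fin m, r + s ≤ i → c i = 0) (hsupp' : ∀ i : Fin m, (i : ℕ) < r → c' i = 0) :
    ∑ i : Fin m, w i * c' i ≤ ∑ i : Fin m, w i * c i := by
  -- Both sums are compared with the one for the indicator of `[r, r + s)`, which also has mass `s`.
  -- As the masses agree, subtracting the constants `w r` and `w (r + s)` changes nothing and makes
  -- every summand nonnegative.
  set e : Fin m → ℝ := fun i => if r ≤ (i : ℕ) ∧ (i : ℕ) < r + s then 1 else 0 with he
  have hes : ∑ i, e i = s := sum_ite_mem_Ico h
  have h1 : 0 ≤ ∑ i : Fin m, (w i - w r) * (c i - e i) := by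
    refine Finset.sum_nonneg fun i _ => ?_
    rcases lt_or_ge (i : ℕ) r with hi | hi
    · have : e i = 0 := if_neg (by omega)
      rw [this, sub_zero]
      exact mul_nonneg (sub_nonneg.mpr (hw hi.le)) (hc0 i)
    · rcases lt_or_ge (i : ℕ) (r + s) with hi' | hi'
      · have : e i = 1 := if_pos ⟨hi, hi'⟩
        rw [this]
        exact mul_nonneg_of_nonpos_of_nonpos (sub_nonpos.mpr (hw hi)) (sub_nonpos.mpr (hc1 i))
      · have : e i = 0 := if_neg (by omega)
        simp [this, hsupp i hi']
  have h2 : 0 ≤ ∑ i : Fin m, (w i - w (r + s)) * (e i - c' i) := by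
    refine Finset.sum_nonneg fun i _ => ?_
    rcases lt_or_ge (i : ℕ) r with hi | hi
    · have : e i = 0 := if_neg (by omega)
      simp [this, hsupp' i hi]
    · rcases lt_or_ge (i : ℕ) (r + s) with hi' | hi'
      · have : e i = 1 := if_pos ⟨hi, hi'⟩
        rw [this]
        exact mul_nonneg (sub_nonneg.mpr (hw hi'.le)) (sub_nonneg.mpr (hc1' i))
      · have : e i = 0 := if_neg (by omega)
        rw [this]
        exact mul_nonneg_of_nonpos_of_nonpos (sub_nonpos.mpr (hw hi')) (by linarith [hc0' i])
  simp only [sub_mul, mul_sub, Finset.sum_sub_distrib, ← Finset.mul_sum, hc, hc', hes] at h1 h2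
  linarith

/-! ### Perturbation of leading singular spaces without a gap -/

section SVD

variable {m : ℕ} {κ : Type} [Fintype κ]

/-- Turns captured energy into a weighted sum of squared singular values. The cutoff at
`Fintype.card κ` is needed since `σ` lives on all of `ℕ`, while rows of `Σ` beyond its last column
vanish. -/
theorem IsSVD.frobSq_transpose_mul {D : Matrix (Fin m) κ ℝ} {W : Matrix (Fin m) (Fin m) ℝ}
    {σ : ℕ → ℝ} {V : Matrix κ (Fin (Fintype.card κ)) ℝ} (h : IsSVD D W σ V) {s : ℕ}
    (R : Matrix (Fin m) (Fin s) ℝ) :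
    frobSq (Rᵀ * D) = ∑ i : Fin m, (if (i : ℕ) < Fintype.card κ then σ i ^ 2 else 0) *
      ∑ a, (Wᵀ * R) i a ^ 2 := by
  set S : Matrix (Fin m) (Fin (Fintype.card κ)) ℝ :=
    Matrix.of (fun i j => if (i : ℕ) = (j : ℕ) then σ i else 0) with hS
  have hSS : S * Sᵀ = diagonal
      (fun i : Fin m => if (i : ℕ) < Fintype.card κ then σ i ^ 2 else 0) := by
    ext i i'
    simp only [mul_apply, transpose_apply, hS, of_apply, diagonal_apply]
    by_cases hii : i = i'
    · subst hii
      rw [if_pos rfl]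
      split_ifs with hi
      · rw [Finset.sum_eq_single ⟨i, hi⟩]
        · simp [sq]
        · intro j _ hj
          rw [if_neg, zero_mul]
          exact fun hij => hj (Fin.ext hij.symm)
        · simp
      · refine Finset.sum_eq_zero fun j _ => ?_
        rw [if_neg, zero_mul]
        omega
    · rw [if_neg hii]
      refine Finset.sum_eq_zero fun j _ => ?_
      split_ifs with h1 h2
      · exact absurd (Fin.ext (h1.trans h2.symm)) hii
      all_goals simp
  have h1 : Rᵀ * D = (Rᵀ * W * S) * Vᵀ := by
    rw [h.eq_mul, ← Matrix.mul_assoc, ← Matrix.mul_assoc]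
  rw [h1, frobSq_mul_transpose_of_orthonormalColumns h.right_orthonormal, ← frobSq_transpose,
    frobSq_eq_trace, transpose_transpose, transpose_mul, Matrix.mul_assoc, ← Matrix.mul_assoc S,
    hSS, trace_mul_comm, Matrix.mul_assoc]
  simp only [trace, diag, diagonal_mul]
  refine Finset.sum_congr rfl fun i _ => ?_
  congr 1
  rw [mul_apply]
  refine Finset.sum_congr rfl fun a _ => ?_
  rw [sq]
  congr 1 <;> simp [mul_apply, mul_comm]

theorem IsSVD.orthonormalColumns_transpose_mul {D : Matrix (Fin m) κ ℝ}
    {W : Matrix (Fin m) (Fin m) ℝ} {σ : ℕ → ℝ} {V : Matrix κ (Fin (Fintype.card κ)) ℝ}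
    (h : IsSVD D W σ V) {s : ℕ} {R : Matrix (Fin m) (Fin s) ℝ} (hR : OrthonormalColumns R) :
    OrthonormalColumns (Wᵀ * R) := by
  have hW : W * Wᵀ = 1 := mul_eq_one_comm.mp h.left_orthonormal
  rw [OrthonormalColumns, transpose_mul, transpose_transpose, Matrix.mul_assoc,
    ← Matrix.mul_assoc W, hW, Matrix.one_mul, hR]

/-- The squared row norms of `Wᵀ * N` and `Wᵀ * R` are weights in `[0, 1]` of mass `s`. Those of `N`
avoid the first `r` singular values and those of `R` sit on the first `r + s`, so the block `[r, r +
s)` separates the two energies. -/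
theorem IsSVD.frobSq_le {D : Matrix (Fin m) κ ℝ} {W : Matrix (Fin m) (Fin m) ℝ}
    {σ : ℕ → ℝ} {V : Matrix κ (Fin (Fintype.card κ)) ℝ} (h : IsSVD D W σ V) {r s : ℕ}
    (hrs : r + s ≤ m) {N R : Matrix (Fin m) (Fin s) ℝ} (hN : OrthonormalColumns N)
    (hR : OrthonormalColumns R) (hNW : ∀ (i : Fin m) a, (i : ℕ) < r → (Wᵀ * N) i a = 0)
    (hRW : ∀ (i : Fin m) a, r + s ≤ (i : ℕ) → (Wᵀ * R) i a = 0) :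
    frobSq (Nᵀ * D) ≤ frobSq (Rᵀ * D) := by
  rw [h.frobSq_transpose_mul, h.frobSq_transpose_mul]
  have hN' := h.orthonormalColumns_transpose_mul hN
  have hR' := h.orthonormalColumns_transpose_mul hR
  refine sum_mul_le_sum_mul_of_antitone hrs
    (w := fun i => if i < Fintype.card κ then σ i ^ 2 else 0) ?_
    (fun _ => Finset.sum_nonneg fun _ _ => sq_nonneg _) hR'.sum_row_sq_le_one
    (hR'.frobSq_eq.trans (by simp))
    (fun _ => Finset.sum_nonneg fun _ _ => sq_nonneg _) hN'.sum_row_sq_le_one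
    (hN'.frobSq_eq.trans (by simp))
    (fun i hi => Finset.sum_eq_zero fun a _ => by rw [hRW i a hi]; simp)
    (fun i hi => Finset.sum_eq_zero fun a _ => by rw [hNW i a hi]; simp)
  intro i j hij
  dsimp only
  split_ifs with h1 h2
  · exact pow_le_pow_left₀ (h.nonneg j) (h.antitone hij) 2
  · omega
  · exact sq_nonneg _
  · exact le_rfl

theorem IsSVDLeft.orthonormalColumns {D : Matrix (Fin m) κ ℝ} {r : ℕ}
    {U : Matrix (Fin m) (Fin r) ℝ} (h : IsSVDLeft D r U) : OrthonormalColumns U := by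
  obtain ⟨hr, W, σ, V, hsvd, rfl⟩ := h
  rw [OrthonormalColumns, transpose_submatrix, ← submatrix_mul _ _ _ _ _ Function.bijective_id,
    hsvd.left_orthonormal, submatrix_one _ (Fin.castLE_injective hr)]

/-- Perturbation bound for the leading left singular space of `A + E` with `A` of rank at most
`r`: the part of `A` that it misses is at most twice the best rank-`r` part of `E`. -/
theorem IsSVDLeft.sqrt_frobSq_le {A E : Matrix (Fin m) κ ℝ} {r : ℕ}
    {U : Matrix (Fin m) (Fin r) ℝ} (h : IsSVDLeft (A + E) r U) (hA : A.rank ≤ r) {b : ℝ}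
    (hb : ∀ V : Matrix (Fin m) (Fin r) ℝ, OrthonormalColumns V → √(frobSq (Vᵀ * E)) ≤ b) :
    √(frobSq ((1 - proj U) * A)) ≤ 2 * b := by
  classical
  have hU := h.orthonormalColumns
  obtain ⟨hr, W, σ, V, hsvd, hUW⟩ := h
  set Q := 1 - proj U with hQ
  have hUQ : Uᵀ * Q = 0 := by
    rw [hQ, proj, Matrix.mul_sub, ← Matrix.mul_assoc, show Uᵀ * U = 1 from hU]
    simp
  set s := (Q * A).rank
  have hsr : s ≤ r := (rank_mul_le_right _ _).trans hA
  obtain ⟨N, hN, hNmem, hspan⟩ := exists_orthonormalColumns_mem (s := s)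
    (LinearMap.range (Q * A).mulVecLin) le_rfl
  have hUN : Uᵀ * N = 0 := by
    ext i j
    obtain ⟨x, hx⟩ := hNmem j
    have h1 : Uᵀ *ᵥ (N.col j) = 0 := by
      rw [← hx, mulVecLin_apply, mulVec_mulVec, ← Matrix.mul_assoc, hUQ]
      simp
    exact congrFun h1 i
  have hNU : Nᵀ * U = 0 := by simpa using congrArg transpose hUN
  -- `N` spans the range of `Q * A` and is orthogonal to `U`, so `Q` disappears under `Nᵀ`.
  have hNN : Q * A = N * (Nᵀ * A) := by
    have h1 : N * (Nᵀ * (Q * A)) = Q * A := by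
      ext i j
      have h2 := hspan rfl ((Q * A).col j) ⟨Pi.single j 1, by
        rw [mulVecLin_apply, mulVec_single_one]⟩
      exact congrFun h2 i
    rw [← h1, ← Matrix.mul_assoc Nᵀ, hQ, proj, Matrix.mul_sub, ← Matrix.mul_assoc Nᵀ U, hNU]
    simp
  have hrs : r + s ≤ m := by simpa using (hU.fromCols hN hUN).card_le
  -- As `s ≤ r`, padding to `r` columns makes the hypothesis on `b` available for `s`-column
  -- matrices.
  have hbs : ∀ M : Matrix (Fin m) (Fin s) ℝ, OrthonormalColumns M → √(frobSq (Mᵀ * E)) ≤ b := by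
    intro M hM
    obtain ⟨V', hV', hle⟩ := hM.exists_extension hsr hr
    exact (Real.sqrt_le_sqrt (hle E)).trans (hb V' hV')
  let L : Matrix (Fin (m - (r + s))) (Fin m) ℝ :=
    Wᵀ.submatrix (fun i => ⟨r + s + i, by omega⟩) id
  -- `R` is chosen orthogonal to the columns of `A`, where only `E` is seen, and inside the span of
  -- the first `r + s` left singular vectors, which is the kernel of `L`. The dimensions are at
  -- least `m - r` and `r + s`, so the intersection has dimension at least `s`.
  obtain ⟨R, hR, hRmem, -⟩ := exists_orthonormalColumns_mem (s := s)
    (LinearMap.ker Aᵀ.mulVecLin ⊓ LinearMap.ker L.mulVecLin) (by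
      have h1 := finrank_ker_mulVecLin Aᵀ
      have h2 := finrank_ker_mulVecLin L
      have h3 : L.rank ≤ m - (r + s) := by simpa using L.rank_le_card_height
      have h4 := Submodule.finrank_sup_add_finrank_inf_eq
        (LinearMap.ker Aᵀ.mulVecLin) (LinearMap.ker L.mulVecLin)
      have h5 := Submodule.finrank_le
        (LinearMap.ker Aᵀ.mulVecLin ⊔ LinearMap.ker L.mulVecLin)
      rw [rank_transpose] at h1
      simp only [Module.finrank_fin_fun] at h5
      omega)
  have hRA : Rᵀ * A = 0 := by
    have h1 : Aᵀ * R = 0 := by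
      ext i j
      exact congrFun (LinearMap.mem_ker.mp (hRmem j).1) i
    simpa using congrArg transpose h1
  have hRW : ∀ (i : Fin m) a, r + s ≤ (i : ℕ) → (Wᵀ * R) i a = 0 := by
    intro i a hi
    have h1 := congrFun (LinearMap.mem_ker.mp (hRmem a).2) ⟨i - (r + s), by omega⟩
    have h2 : (⟨r + s + (i - (r + s)), by omega⟩ : Fin m) = i := Fin.ext (by simp; omega)
    simp only [mulVecLin_apply, mulVec, dotProduct, L, submatrix_apply, h2] at h1
    simpa [mul_apply] using h1
  have hNW : ∀ (i : Fin m) a, (i : ℕ) < r → (Wᵀ * N) i a = 0 := by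
    intro i a hi
    have h1 := congrFun (congrFun hUN ⟨i, hi⟩) a
    rw [hUW] at h1
    simpa [mul_apply] using h1
  have hle := hsvd.frobSq_le hrs hN hR hNW hRW
  rw [hNN, frobSq_mul_of_orthonormalColumns hN]
  have hsplit : Nᵀ * A = Nᵀ * (A + E) + -(Nᵀ * E) := by
    rw [Matrix.mul_add]; abel
  have hneg : frobSq (-(Nᵀ * E)) = frobSq (Nᵀ * E) := by simp [frobSq]
  have hRE : Rᵀ * (A + E) = Rᵀ * E := by rw [Matrix.mul_add, hRA, zero_add]
  rw [hRE] at hle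
  calc √(frobSq (Nᵀ * A)) ≤ √(frobSq (Nᵀ * (A + E))) + √(frobSq (Nᵀ * E)) := by
        rw [hsplit, ← hneg]
        exact sqrt_frobSq_add_le _ _
    _ ≤ √(frobSq (Rᵀ * E)) + √(frobSq (Nᵀ * E)) := by gcongr
    _ ≤ 2 * b := by linarith [hbs R hR, hbs N hN]

end SVD

/-! ### Multi-mode products and changing one mode at a time -/

section Tensor

variable {d : ℕ} {p q r : Fin d → ℕ}

theorem frobNorm_eq_matricize (k : Fin d) (A : Tensor p) :
    frobNorm A = √(frobSq (matricize k A)) := by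
  rw [frobNorm, frobSq, ← Fintype.sum_prod_type',
    ← (Equiv.piSplitAt k (fun j => Fin (p j))).symm.sum_comp]
  rfl

theorem matricize_injective (k : Fin d) :
    Function.Injective (matricize k : Tensor p → _) := by
  intro A A' h
  funext i
  obtain ⟨x, rfl⟩ := (Equiv.piSplitAt k (fun j => Fin (p j))).symm.surjective i
  exact congrFun (congrFun h x.1) x.2

theorem frobNorm_add_le (A B : Tensor p) : frobNorm (A + B) ≤ frobNorm A + frobNorm B :=
  sqrt_sum_sq_add_le A B

theorem frobNorm_nonneg (A : Tensor p) : 0 ≤ frobNorm A :=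
  Real.sqrt_nonneg _

theorem frobNorm_neg (A : Tensor p) : frobNorm (-A) = frobNorm A := by
  simp [frobNorm]

theorem prod_one_apply {ι : Type*} [Fintype ι] {n : ι → ℕ} (i j : (k : ι) → Fin (n k)) :
    ∏ k, (1 : Matrix (Fin (n k)) (Fin (n k)) ℝ) (i k) (j k) = if i = j then 1 else 0 := by
  split_ifs with h
  · subst h
    simp
  · obtain ⟨k, hk⟩ := Function.ne_iff.mp h
    exact Finset.prod_eq_zero (Finset.mem_univ k) (one_apply_ne hk)

theorem modeProd_one (A : Tensor p) : modeProd A (fun _ => 1) = A := by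
  funext i
  simp [modeProd, prod_one_apply]

theorem modeProd_modeProd (A : Tensor p) (B : (k : Fin d) → Matrix (Fin (q k)) (Fin (p k)) ℝ)
    (C : (k : Fin d) → Matrix (Fin (r k)) (Fin (q k)) ℝ) :
    modeProd (modeProd A B) C = modeProd A fun k => C k * B k := by
  funext i
  simp only [modeProd, mul_apply, Finset.prod_univ_sum, Fintype.piFinset_univ, Finset.mul_sum,
    Finset.sum_mul, Finset.prod_mul_distrib]
  rw [Finset.sum_comm]
  simp only [mul_assoc]

theorem modeProd_add (A A' : Tensor p) (B : (k : Fin d) → Matrix (Fin (q k)) (Fin (p k)) ℝ) :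
    modeProd (A + A') B = modeProd A B + modeProd A' B := by
  funext i
  simp [modeProd, mul_add, Finset.sum_add_distrib]

/-- The Kronecker product of all the matrices `B j` except the `k`-th one. -/
def kronExcept (k : Fin d) (B : (j : Fin d) → Matrix (Fin (q j)) (Fin (p j)) ℝ) :
    Matrix ((j : {j : Fin d // j ≠ k}) → Fin (q j)) ((j : {j : Fin d // j ≠ k}) → Fin (p j)) ℝ :=
  Matrix.of fun c e =>
    ∏ j : {j : Fin d // j ≠ k}, B j (c j) (e j)

theorem matricizeModeProdExcept_eq (k : Fin d) (A : Tensor p)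
    (B : (j : Fin d) → Matrix (Fin (q j)) (Fin (p j)) ℝ) :
    matricizeModeProdExcept k A B = matricize k A * (kronExcept k B)ᵀ := by
  ext i c
  simp [matricizeModeProdExcept, kronExcept, mul_apply, mul_comm]

theorem kronExcept_mul (k : Fin d) (C : (j : Fin d) → Matrix (Fin (r j)) (Fin (q j)) ℝ)
    (B : (j : Fin d) → Matrix (Fin (q j)) (Fin (p j)) ℝ) :
    (kronExcept k fun j => C j * B j) = kronExcept k C * kronExcept k B := by
  ext c e
  simp only [kronExcept, of_apply, mul_apply, Finset.prod_univ_sum, Fintype.piFinset_univ,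
    Finset.prod_mul_distrib]

theorem OrthonormalColumns.kronExcept (k : Fin d)
    {U : (j : Fin d) → Matrix (Fin (p j)) (Fin (r j)) ℝ} (hU : ∀ j, OrthonormalColumns (U j)) :
    OrthonormalColumns (kronExcept k U) := by
  have h : (TuckerHOOI.kronExcept k U)ᵀ = TuckerHOOI.kronExcept k fun j => (U j)ᵀ := rfl
  rw [OrthonormalColumns, h, ← kronExcept_mul]
  ext c e
  simp only [TuckerHOOI.kronExcept, of_apply, show ∀ j, (U j)ᵀ * U j = 1 from hU]
  rw [one_apply]
  exact prod_one_apply c e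

theorem matricizeModeProdExcept_add (k : Fin d) (A A' : Tensor p)
    (B : (j : Fin d) → Matrix (Fin (q j)) (Fin (p j)) ℝ) :
    matricizeModeProdExcept k (A + A') B =
      matricizeModeProdExcept k A B + matricizeModeProdExcept k A' B := by
  simp only [matricizeModeProdExcept_eq, ← Matrix.add_mul]
  rfl

theorem rank_matricizeModeProdExcept_le (k : Fin d) (A : Tensor p)
    (B : (j : Fin d) → Matrix (Fin (q j)) (Fin (p j)) ℝ) :
    (matricizeModeProdExcept k A B).rank ≤ tuckerRank A k := by
  rw [matricizeModeProdExcept_eq]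
  exact rank_mul_le_left _ _

/-- The algorithm compresses by `(U j)ᵀ`, whereas `Z_max` is defined by projections. The two differ
by a Kronecker factor with orthonormal columns, which preserves the norm. -/
theorem frobSq_mul_matricizeModeProdExcept {l : ℕ} (k : Fin d) (A : Tensor p)
    {U : (j : Fin d) → Matrix (Fin (p j)) (Fin (r j)) ℝ} (hU : ∀ j, OrthonormalColumns (U j))
    (M : Matrix (Fin l) (Fin (p k)) ℝ) :
    frobSq (M * matricizeModeProdExcept k A fun j => (U j)ᵀ) =
      frobSq (M * matricizeModeProdExcept k A fun j => proj (U j)) := by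
  rw [← frobSq_mul_transpose_of_orthonormalColumns (OrthonormalColumns.kronExcept k hU)]
  simp only [matricizeModeProdExcept_eq, proj, kronExcept_mul, transpose_mul, Matrix.mul_assoc]

theorem matricize_modeProd_update (k : Fin d) (A : Tensor p)
    (B : (j : Fin d) → Matrix (Fin (q j)) (Fin (p j)) ℝ) (M : Matrix (Fin (q k)) (Fin (p k)) ℝ) :
    matricize k (modeProd A (Function.update B k M)) = M * matricizeModeProdExcept k A B := by
  rw [matricize_modeProd, Function.update_self]
  congr 1
  ext i c
  simp only [matricizeModeProdExcept, of_apply]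
  refine Finset.sum_congr rfl fun e _ => ?_
  congr 1
  exact Finset.prod_congr rfl fun j _ => by rw [Function.update_of_ne j.2]

theorem modeProd_update_add (k : Fin d) (A : Tensor p)
    (B : (j : Fin d) → Matrix (Fin (q j)) (Fin (p j)) ℝ)
    (M N : Matrix (Fin (q k)) (Fin (p k)) ℝ) :
    modeProd A (Function.update B k (M + N)) =
      modeProd A (Function.update B k M) + modeProd A (Function.update B k N) := by
  apply matricize_injective k
  change _ = matricize k (modeProd A (Function.update B k M)) +
    matricize k (modeProd A (Function.update B k N))
  simp only [matricize_modeProd_update, Matrix.add_mul]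

/-- Mode-wise domination of the factors bounds the norm of the multi-mode product. -/
theorem frobNorm_modeProd_sq_le (A : Tensor p)
    (F G : (k : Fin d) → Matrix (Fin (q k)) (Fin (p k)) ℝ) (c : Fin d → ℝ) (hc : ∀ k, 0 ≤ c k)
    (h : ∀ k {κ : Type} [Fintype κ] (X : Matrix (Fin (p k)) κ ℝ),
      frobSq (F k * X) ≤ c k * frobSq (G k * X)) :
    frobNorm (modeProd A F) ^ 2 ≤ (∏ k, c k) * frobNorm (modeProd A G) ^ 2 := by
  have key : ∀ S : Finset (Fin d), frobNorm (modeProd A F) ^ 2 ≤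
      (∏ k ∈ S, c k) * frobNorm (modeProd A fun k => if k ∈ S then G k else F k) ^ 2 := by
    intro S
    induction S using Finset.induction_on with
    | empty => simp
    | insert k S hk ih =>
      refine ih.trans ?_
      rw [Finset.prod_insert hk, mul_comm (c k), mul_assoc]
      refine mul_le_mul_of_nonneg_left ?_ (Finset.prod_nonneg fun k _ => hc k)
      set B : (k : Fin d) → Matrix (Fin (q k)) (Fin (p k)) ℝ :=
        fun k => if k ∈ S then G k else F k with hB
      have h1 : B = Function.update B k (F k) := by
        rw [eq_comm, Function.update_eq_self_iff, hB]
        exact (if_neg hk).symm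
      have h2 : (fun j => if j ∈ insert k S then G j else F j) = Function.update B k (G k) := by
        funext j
        rcases eq_or_ne j k with rfl | hj
        · simp
        · rw [Function.update_of_ne hj, hB]
          simp [hj]
      rw [h2, h1, Function.update_idem, frobNorm_eq_matricize k, frobNorm_eq_matricize k,
        Real.sq_sqrt (frobSq_nonneg _), Real.sq_sqrt (frobSq_nonneg _),
        matricize_modeProd_update, matricize_modeProd_update]
      exact h k _
  simpa using key Finset.univ

theorem frobNorm_modeProd_le (A : Tensor p)
    (F G : (k : Fin d) → Matrix (Fin (q k)) (Fin (p k)) ℝ)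
    (h : ∀ k {κ : Type} [Fintype κ] (X : Matrix (Fin (p k)) κ ℝ),
      frobSq (F k * X) ≤ frobSq (G k * X)) :
    frobNorm (modeProd A F) ≤ frobNorm (modeProd A G) := by
  have h1 := frobNorm_modeProd_sq_le A F G (fun _ => 1) (fun _ => zero_le_one)
    (fun k κ _ X => by simpa using h k X)
  simp only [Finset.prod_const_one, one_mul] at h1
  exact (pow_le_pow_iff_left₀ (frobNorm_nonneg _) (frobNorm_nonneg _) two_ne_zero).mp h1

/-- Telescoping: exchanging `1` for `P k` costs a term with `1 - P k` in mode `k` and contractions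
or identities elsewhere, and dropping the contractions only increases it. -/
theorem frobNorm_modeProd_sub_le (A : Tensor p)
    (P : (k : Fin d) → Matrix (Fin (p k)) (Fin (p k)) ℝ)
    (h : ∀ k {κ : Type} [Fintype κ] (X : Matrix (Fin (p k)) κ ℝ),
      frobSq (P k * X) ≤ frobSq X) :
    frobNorm (modeProd A P - A) ≤
      ∑ k, frobNorm (modeProd A (Function.update (fun _ => 1) k (1 - P k))) := by
  have key : ∀ S : Finset (Fin d),
      frobNorm (modeProd A (fun k => if k ∈ S then P k else 1) - A) ≤
        ∑ k ∈ S, frobNorm (modeProd A (Function.update (fun _ => 1) k (1 - P k))) := by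
    intro S
    induction S using Finset.induction_on with
    | empty => simp [modeProd_one, frobNorm]
    | insert k S hk ih =>
      set B : (k : Fin d) → Matrix (Fin (p k)) (Fin (p k)) ℝ :=
        fun k => if k ∈ S then P k else 1 with hB
      have h1 : B = Function.update B k (P k + (1 - P k)) := by
        rw [eq_comm, Function.update_eq_self_iff, hB]
        simp [hk]
      have h2 : (fun j => if j ∈ insert k S then P j else 1) = Function.update B k (P k) := by
        funext j
        rcases eq_or_ne j k with rfl | hj
        · simp
        · rw [Function.update_of_ne hj, hB]
          simp [hj]
      have h3 : modeProd A (Function.update B k (P k)) - A =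
          -modeProd A (Function.update B k (1 - P k)) + (modeProd A B - A) := by
        conv_rhs => rw [h1, Function.update_idem, modeProd_update_add]
        abel
      rw [Finset.sum_insert hk, h2, h3]
      refine (frobNorm_add_le _ _).trans (add_le_add ?_ ih)
      rw [frobNorm_neg]
      refine frobNorm_modeProd_le _ _ _ fun j κ _ X => ?_
      rcases eq_or_ne j k with rfl | hj
      · simp
      · rw [Function.update_of_ne hj, Function.update_of_ne hj, hB, Matrix.one_mul]
        dsimp only
        split_ifs
        · exact h j X
        · rw [Matrix.one_mul]
  simpa using key Finset.univ

end Tensor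

/-! ### Projections and the initialization condition -/

section Contraction

variable {m r : ℕ}

theorem frobSq_proj_mul {κ : Type} [Fintype κ] {U : Matrix (Fin m) (Fin r) ℝ}
    (hU : OrthonormalColumns U) (X : Matrix (Fin m) κ ℝ) :
    frobSq (proj U * X) = frobSq (Uᵀ * X) := by
  rw [proj, Matrix.mul_assoc, frobSq_mul_of_orthonormalColumns hU]

/-- Pythagoras: `[U V]` is square with orthonormal columns, hence orthogonal, and its transpose
preserves the norm. -/
theorem frobSq_transpose_mul_add_complement {κ : Type} [Fintype κ] {U : Matrix (Fin m) (Fin r) ℝ}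
    (hU : OrthonormalColumns U) {V : Matrix (Fin m) (Fin (m - r)) ℝ}
    (hV : IsOrthonormalComplement U V) (X : Matrix (Fin m) κ ℝ) :
    frobSq (Uᵀ * X) + frobSq (Vᵀ * X) = frobSq X := by
  have hrm : r ≤ m := by simpa using hU.card_le
  have h1 := hU.fromCols hV.1 hV.2
  let e : Fin m ≃ Fin r ⊕ Fin (m - r) := (finCongr (by omega)).trans finSumFinEquiv.symm
  have h2 : fromCols U V * (fromCols U V)ᵀ = 1 := (mul_eq_one_comm_of_equiv e).mpr h1
  have h3 : OrthonormalColumns (fromCols U V)ᵀ := by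
    rw [OrthonormalColumns, transpose_transpose, h2]
  rw [← frobSq_mul_of_orthonormalColumns h3 X, transpose_fromCols, fromRows_mul]
  simp [frobSq]

theorem exists_isOrthonormalComplement {U : Matrix (Fin m) (Fin r) ℝ} :
    ∃ V, IsOrthonormalComplement U V := by
  have hk := finrank_ker_mulVecLin Uᵀ
  have hr : Uᵀ.rank ≤ r := by simpa using Uᵀ.rank_le_card_height
  obtain ⟨V, hV, hmem, -⟩ := exists_orthonormalColumns_mem (s := m - r)
    (LinearMap.ker Uᵀ.mulVecLin) (by omega)
  refine ⟨V, hV, ?_⟩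
  ext i j
  exact congrFun (LinearMap.mem_ker.mp (hmem j)) i

theorem frobSq_proj_mul_le {κ : Type} [Fintype κ] {U : Matrix (Fin m) (Fin r) ℝ}
    (hU : OrthonormalColumns U) (X : Matrix (Fin m) κ ℝ) :
    frobSq (proj U * X) ≤ frobSq X := by
  obtain ⟨V, hV⟩ := exists_isOrthonormalComplement (U := U)
  rw [frobSq_proj_mul hU, ← frobSq_transpose_mul_add_complement hU hV X]
  exact le_add_of_nonneg_right (frobSq_nonneg _)

open scoped Matrix.Norms.L2Operator in
theorem specNorm_nonneg {l : ℕ} (M : Matrix (Fin l) (Fin m) ℝ) : 0 ≤ specNorm M :=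
  norm_nonneg M

open scoped Matrix.Norms.L2Operator in
theorem frobSq_mul_le_specNorm {κ : Type} [Fintype κ] {l : ℕ} (M : Matrix (Fin l) (Fin m) ℝ)
    (X : Matrix (Fin m) κ ℝ) : frobSq (M * X) ≤ specNorm M ^ 2 * frobSq X := by
  rw [← frobSq_transpose, ← frobSq_transpose X, frobSq, frobSq, Finset.mul_sum]
  refine Finset.sum_le_sum fun j _ => ?_
  have h := pow_le_pow_left₀ (norm_nonneg _)
    (l2_opNorm_mulVec M (WithLp.toLp 2 (X.col j))) 2
  rw [mul_pow, EuclideanSpace.real_norm_sq_eq, EuclideanSpace.real_norm_sq_eq] at h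
  exact h

/-- If `‖U_⊥ᵀ V‖ ≤ √2 / 2`, projecting the range of `V` onto that of `U` shrinks squared norms at
most by a factor two. -/
theorem frobSq_mul_le_two_mul {κ : Type} [Fintype κ] {l : ℕ} {U : Matrix (Fin m) (Fin r) ℝ}
    (hU : OrthonormalColumns U) {U' : Matrix (Fin m) (Fin (m - r)) ℝ}
    (hU' : IsOrthonormalComplement U U') {V : Matrix (Fin m) (Fin l) ℝ}
    (hV : OrthonormalColumns V) (h : specNorm (U'ᵀ * V) ≤ √2 / 2) (X : Matrix (Fin l) κ ℝ) :
    frobSq (V * X) ≤ 2 * frobSq (proj U * V * X) := by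
  have h1 := frobSq_transpose_mul_add_complement hU hU' (V * X)
  have h2 := frobSq_mul_le_specNorm (U'ᵀ * V) X
  -- The complement carries at most half of the squared norm of `V * X`, so the projection onto `U`
  -- keeps at least half.
  have h3 : specNorm (U'ᵀ * V) ^ 2 ≤ 1 / 2 := by
    have h4 := pow_le_pow_left₀ (specNorm_nonneg (U'ᵀ * V)) h 2
    rw [div_pow, Real.sq_sqrt zero_le_two] at h4
    linarith
  rw [Matrix.mul_assoc] at h2 ⊢
  rw [frobSq_proj_mul hU]
  rw [← frobSq_mul_of_orthonormalColumns hV X] at h2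
  nlinarith [frobSq_nonneg (V * X)]

end Contraction

/-! ### Assembling the bound -/

theorem IsMaxTucker.frobNorm_le {d : ℕ} {p : Fin d → ℕ} {Z Y : Tensor p} {r : Fin d → ℕ}
    (h : IsMaxTucker Z r Y) {U : (k : Fin d) → Matrix (Fin (p k)) (Fin (r k)) ℝ}
    (hU : ∀ k, OrthonormalColumns (U k)) :
    frobNorm (modeProd Z fun k => proj (U k)) ≤ frobNorm Y := by
  obtain ⟨V, -, hmax, rfl⟩ := h
  exact hmax U hU

end TuckerHOOI

/-- The constant for one mode: `√2` for each of the other `d - 1` modes, times the `2` of the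
singular space bound. Positivity of `d` keeps the subtraction from truncating. -/
theorem two_mul_sqrt_two_pow_pred {d : ℕ} (hd : 0 < d) :
    √((2 : ℝ) ^ (d - 1)) * 2 = (2 : ℝ) ^ (((d : ℝ) + 1) / 2) := by
  obtain ⟨n, rfl⟩ := Nat.exists_eq_succ_of_ne_zero hd.ne'
  rw [Real.sqrt_eq_rpow, Nat.succ_sub_one, ← Real.rpow_natCast, ← Real.rpow_mul zero_le_two]
  rw [← Real.rpow_add_one two_ne_zero]
  congr 1
  push_cast
  ring

theorem mainTheorem10 (d : ℕ) (p r rs : Fin d → ℕ)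
    (T T' : TuckerHOOI.Tensor p)
    (hrank : TuckerHOOI.tuckerRank T = rs)
    (B : TuckerHOOI.Tensor rs)
    (U : (k : Fin d) → Matrix (Fin (p k)) (Fin (rs k)) ℝ)
    (hU : ∀ k, TuckerHOOI.OrthonormalColumns (U k))
    (hT : T = TuckerHOOI.modeProd B U)
    (hr : ∀ k, rs k ≤ r k)
    (U0 : (k : Fin d) → Matrix (Fin (p k)) (Fin (r k)) ℝ)
    (hU0 : ∀ k, TuckerHOOI.OrthonormalColumns (U0 k))
    (U0perp : (k : Fin d) → Matrix (Fin (p k)) (Fin (p k - r k)) ℝ)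
    (hU0perp : ∀ k, TuckerHOOI.IsOrthonormalComplement (U0 k) (U0perp k))
    (hinit : ∀ k, TuckerHOOI.specNorm ((U0perp k).transpose * U k) ≤ Real.sqrt 2 / 2)
    (That : TuckerHOOI.Tensor p)
    (hThat : TuckerHOOI.IsOHOOIOutput T' r U0 That)
    (Zmax : TuckerHOOI.Tensor p)
    (hZmax : TuckerHOOI.IsMaxTucker (T' - T) r Zmax) :
    TuckerHOOI.frobNorm (That - T) ≤
      ((2 : ℝ) ^ (((d : ℝ) + 1) / 2) * (d : ℝ) + 1) * TuckerHOOI.frobNorm Zmax := by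
  open TuckerHOOI in
  obtain ⟨U1, hsvd, rfl⟩ := hThat
  have hU1 := fun k => (hsvd k).orthonormalColumns
  have hT' : T' = T + (T' - T) := by abel
  set Z := T' - T
  have hmode : ∀ k, frobNorm (modeProd T
      (Function.update (fun j => (1 : Matrix (Fin (p j)) (Fin (p j)) ℝ)) k
      (1 - proj (U1 k)))) ≤
      (2 : ℝ) ^ (((d : ℝ) + 1) / 2) * frobNorm Zmax := by
    intro k
    set Q := 1 - proj (U1 k)
    have hmatrix : frobNorm (modeProd T (Function.update (fun j => proj (U0 j)) k Q)) ≤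
        2 * frobNorm Zmax := by
      rw [frobNorm_eq_matricize k, matricize_modeProd_update,
        ← frobSq_mul_matricizeModeProdExcept k T hU0]
      have hs := hsvd k
      rw [hT', matricizeModeProdExcept_add] at hs
      refine hs.sqrt_frobSq_le
        ((rank_matricizeModeProdExcept_le k T _).trans (by rw [hrank]; exact hr k)) ?_
      intro V hV
      -- `V` in mode `k` and `U0` elsewhere compete in the maximization defining `Zmax`.
      have hV' : ∀ j, OrthonormalColumns (Function.update U0 k V j) := by
        intro j
        rcases eq_or_ne j k with rfl | hj
        · simpa using hV
        · simpa [hj] using hU0 j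
      have hupd : (fun j => proj (Function.update U0 k V j)) =
          Function.update (fun j => proj (U0 j)) k (proj V) := by
        funext j
        rcases eq_or_ne j k with rfl | hj
        · simp
        · simp [hj]
      refine le_trans (le_of_eq ?_) (hZmax.frobNorm_le hV')
      rw [hupd, frobNorm_eq_matricize k, matricize_modeProd_update, ← frobSq_proj_mul hV,
        frobSq_mul_matricizeModeProdExcept k Z hU0]
    have hloss : frobNorm (modeProd T (Function.update (fun _ => 1) k Q)) ^ 2 ≤
        2 ^ (d - 1) *
          frobNorm (modeProd T (Function.update (fun j => proj (U0 j)) k Q)) ^ 2 := by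
      -- The factor-two bound holds only on the range of `U j`, so the comparison is made on the
      -- core `B`.
      rw [hT, modeProd_modeProd, modeProd_modeProd]
      have h1 := frobNorm_modeProd_sq_le B
        (fun j => Function.update (fun j => (1 : Matrix (Fin (p j)) (Fin (p j)) ℝ)) k Q j * U j)
        (fun j => Function.update (fun j => proj (U0 j)) k Q j * U j)
        -- Both products carry `Q` in mode `k`, so that mode costs nothing.
        (Function.update (fun _ => 2) k 1)
        (fun j => by rcases eq_or_ne j k with rfl | hj <;> simp [*])
        (fun j κ _ X => by
          rcases eq_or_ne j k with rfl | hj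
          · simp
          · simp only [Function.update_of_ne hj, Matrix.one_mul]
            exact frobSq_mul_le_two_mul (hU0 j) (hU0perp j) (hU j) (hinit j) X)
      rw [Finset.prod_update_of_mem (Finset.mem_univ k), one_mul, Finset.prod_const,
        Finset.card_sdiff] at h1
      simpa using h1
    rw [← two_mul_sqrt_two_pow_pred k.pos, mul_assoc]
    refine (Real.le_sqrt_of_sq_le hloss).trans ?_
    rw [Real.sqrt_mul (by positivity), Real.sqrt_sq (frobNorm_nonneg _)]
    exact mul_le_mul_of_nonneg_left hmatrix (Real.sqrt_nonneg _)
  have hsplit : (modeProd T' fun k => proj (U1 k)) - T =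
      ((modeProd T fun k => proj (U1 k)) - T) + modeProd Z fun k => proj (U1 k) := by
    rw [hT', modeProd_add]
    abel
  rw [hsplit]
  refine (frobNorm_add_le _ _).trans ?_
  have h1 := (frobNorm_modeProd_sub_le T (fun k => proj (U1 k))
    fun k κ _ X => frobSq_proj_mul_le (hU1 k) X).trans (Finset.sum_le_sum fun k _ => hmode k)
  have h2 := hZmax.frobNorm_le hU1
  simp only [Finset.sum_const, Finset.card_univ, Fintype.card_fin, nsmul_eq_mul] at h1
  linarith
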